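/- Let $\Xi$ be the Riemann Xi function, i.e. the entire function obtained from $$\Xi(z)=-\frac{1+4z^{2}}{8\,\pi^{(1+2iz)/4}}\,\Gamma\!\left(\frac{1+2iz}{4}\right)\zeta\!\left(\frac{1+2iz}{2}\right)$$ by filling in the removable singularities of the right-hand side (equivalently $\Xi(z)=\xi(\tfrac12+iz)$ with $\xi(s)=\tfrac12 s(s-1)\pi^{-s/2}\Gamma(s/2)\zeta(s)$). (a) There is a function $\phi:\mathbb{R}\to(0,\infty)$ such that for every $z\in\mathbb{C}$ the function $t\mapsto e^{-itz}\phi(t)$ is Lebesgue integrable on $\mathbb{R}$ and $$\Xi(z)=\int_{-\infty}^{\infty}e^{-itz}\phi(t)\,dt .$$ (b) For all $n,m\in\mathbb{N}$ and all complex numbers $z_{j,\ell}$ ($1\le j\le n$, $1\le\ell\le m$), the matrix $$\left(\prod_{\ell=1}^{m}\Xi\left(z_{j,\ell}-\overline{z_{k,\ell}}\right)\right)_{j,k=1}^{n}$$ is positive semidefinite, i.e. $\sum_{j,k=1}^{n}c_{j}\overline{c_{k}}\prod_{\ell=1}^{m}\Xi(z_{j,\ell}-\overline{z_{k,\ell}})\ge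 0$ for all $c_1,\dots,c_n\in\mathbb{C}$. -/

import Mathlib

open Filter Topology
open scoped ComplexOrder

/-- The expression `-(1 + 4 z²) / (8 π^((1 + 2 i z)/4)) · Γ((1 + 2 i z)/4) · ζ((1 + 2 i z)/2)`.
It is holomorphic away from the isolated points where `(1 + 2 i z)/2` is `1` or a pole
`0, -2, -4, …` of `s ↦ Γ(s/2)`; at those points the Lean term has a meaningless value. -/
noncomputable def riemannXiExpr (z : ℂ) : ℂ :=
  -(1 + 4 * z ^ 2) / (8 * (Real.pi : ℂ) ^ ((1 + 2 * Complex.I * z) / 4)) *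
    Complex.Gamma ((1 + 2 * Complex.I * z) / 4) * riemannZeta ((1 + 2 * Complex.I * z) / 2)

/-- The Riemann Xi function: the entire function obtained from `riemannXiExpr` by filling in its
removable singularities, i.e. its value at `z` is the limit of `riemannXiExpr w` as `w → z`,
`w ≠ z`. -/
noncomputable def riemannXi (z : ℂ) : ℂ :=
  limUnder (𝓝[≠] z) riemannXiExpr

/-- Away from its singularities the defining expression is `(s (s - 1) Λ₀(s) + 1) / 2` with
`s = 1/2 + i z`, where `Λ₀` is the (entire) completed zeta function with its poles removed. -/
theorem riemannXiExpr_eq {z : ℂ} (h1 : (1 + 2 * Complex.I * z) / 2 ≠ 1)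
    (hG : (Complex.Gamma ((1 + 2 * Complex.I * z) / 4))⁻¹ ≠ 0) :
    riemannXiExpr z = ((1 + 2 * Complex.I * z) / 2 * ((1 + 2 * Complex.I * z) / 2 - 1) *
      completedRiemannZeta₀ ((1 + 2 * Complex.I * z) / 2) + 1) / 2 := by
  have hG' : Complex.Gamma ((1 + 2 * Complex.I * z) / 4) ≠ 0 := by
    intro h; exact hG (by rw [h, inv_zero])
  have h0 : (1 + 2 * Complex.I * z) / 2 ≠ 0 := by
    intro h
    apply hG'
    have : (1 + 2 * Complex.I * z) / 4 = 0 := by linear_combination h / 2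
    rw [this, Complex.Gamma_zero]
  have hz : -(1 + 4 * z ^ 2) =
      4 * ((1 + 2 * Complex.I * z) / 2 * ((1 + 2 * Complex.I * z) / 2 - 1)) := by
    linear_combination (-4 * z ^ 2) * Complex.I_sq
  have h4 : (1 + 2 * Complex.I * z) / 4 = (1 + 2 * Complex.I * z) / 2 / 2 := by ring
  have hpi : (Real.pi : ℂ) ≠ 0 := by exact_mod_cast Real.pi_ne_zero
  rw [riemannXiExpr, riemannZeta_eq_completedRiemannZeta₀ h0, hz]
  rw [h4] at hG' ⊢
  generalize (1 + 2 * Complex.I * z) / 2 = s at *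
  have hs : 1 - s ≠ 0 := sub_ne_zero.mpr (Ne.symm h1)
  have hp : (Real.pi : ℂ) ^ (s / 2) ≠ 0 := by simp [Complex.cpow_eq_zero_iff, hpi]
  have hn : (Real.pi : ℂ) ^ (-s / 2) = ((Real.pi : ℂ) ^ (s / 2))⁻¹ := by
    rw [neg_div, Complex.cpow_neg]
  rw [hn]
  field_simp
  ring

/-- The limits in the definition of `riemannXi` exist, and `riemannXi` is the entire function
`(s (s - 1) Λ₀(s) + 1) / 2`, `s = 1/2 + i z`. -/
theorem riemannXi_eq (z : ℂ) :
    Tendsto riemannXiExpr (𝓝[≠] z) (𝓝 (riemannXi z)) ∧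
    riemannXi z = ((1 + 2 * Complex.I * z) / 2 * ((1 + 2 * Complex.I * z) / 2 - 1) *
      completedRiemannZeta₀ ((1 + 2 * Complex.I * z) / 2) + 1) / 2 := by
  have hd : Differentiable ℂ fun w : ℂ => (Complex.Gamma ((1 + 2 * Complex.I * w) / 4))⁻¹ :=
    Complex.differentiable_one_div_Gamma.comp
      (g := fun s : ℂ => (Complex.Gamma s)⁻¹) (f := fun w : ℂ => (1 + 2 * Complex.I * w) / 4)
      (by fun_prop)
  have han : AnalyticOnNhd ℂ (fun w : ℂ => (Complex.Gamma ((1 + 2 * Complex.I * w) / 4))⁻¹)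
      Set.univ := fun w _ => hd.analyticAt w
  have hne : ∀ᶠ w in 𝓝[≠] z, (Complex.Gamma ((1 + 2 * Complex.I * w) / 4))⁻¹ ≠ 0 := by
    rcases (han z trivial).eventually_eq_zero_or_eventually_ne_zero with h | h
    · exfalso
      have h' := han.eqOn_zero_of_preconnected_of_eventuallyEq_zero isPreconnected_univ
        (Set.mem_univ z) h (Set.mem_univ (0 : ℂ))
      have : Complex.Gamma ((1 + 2 * Complex.I * 0) / 4) ≠ 0 :=
        Complex.Gamma_ne_zero_of_re_pos (by norm_num)
      exact inv_ne_zero this h'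
    · exact h
  have hone : ∀ᶠ w in 𝓝[≠] z, (1 + 2 * Complex.I * w) / 2 ≠ 1 := by
    have hfin : ∀ᶠ w in 𝓝[≠] z, w ≠ -Complex.I / 2 := by
      by_cases hz : z = -Complex.I / 2
      · subst hz; exact eventually_mem_nhdsWithin
      · exact nhdsWithin_le_nhds (isOpen_ne.mem_nhds hz)
    filter_upwards [hfin] with w hw h
    apply hw
    linear_combination (-Complex.I) * h + w * Complex.I_sq
  have hcont : Continuous fun w : ℂ => ((1 + 2 * Complex.I * w) / 2 *
      ((1 + 2 * Complex.I * w) / 2 - 1) *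
      completedRiemannZeta₀ ((1 + 2 * Complex.I * w) / 2) + 1) / 2 := by
    have := differentiable_completedZeta₀.continuous
    fun_prop
  have ht : Tendsto riemannXiExpr (𝓝[≠] z) (𝓝 (((1 + 2 * Complex.I * z) / 2 *
      ((1 + 2 * Complex.I * z) / 2 - 1) *
      completedRiemannZeta₀ ((1 + 2 * Complex.I * z) / 2) + 1) / 2)) := by
    refine Tendsto.congr' ?_ ((hcont.tendsto z).mono_left nhdsWithin_le_nhds)
    filter_upwards [hne, hone] with w h h1
    exact (riemannXiExpr_eq h1 h).symm
  have he := ht.limUnder_eq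
  exact ⟨by rw [riemannXi, he]; exact ht, he⟩

/-!
Riemann's `ξ(s)` is the Mellin transform at `s / 2` of `K(x) = ∑ₙ (2 y² - 3 y) e^{-y}` with
`y = π n² x`: for `1 < re s` this is integrated term by term, and both sides are entire.
Substituting `x = e^{2t}` turns it into `Ξ(z) = ∫ e^{-itz} φ(t) dt`, where
`φ(t) = 2 e^{t/2} K(e^{2t})`. The functional equation of the theta function says that
`G(t) = e^{t/2} θ(e^{2t})` is even, and `φ = (G'' - G / 4) / 2`, so `φ` is even as well. Since
`π > 3 / 2`, every summand of `K(x)` is positive for `x ≥ 1`, so `φ > 0` on `[0, ∞)`, hence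
everywhere.

Consequently `Ξ(z_j - conj z_k)` is the Gram matrix of the functions `t ↦ e^{i t conj z_j}` in
`L²(φ dt)`, and entrywise products of positive semidefinite matrices are positive semidefinite by
Schur's theorem.
-/

section PositiveSemidefinite

open MeasureTheory

lemma posSemidef_prod {ι κ 𝕜 : Type*} [Finite ι] [RCLike 𝕜] (s : Finset κ)
    {M : κ → Matrix ι ι 𝕜} (hM : ∀ l ∈ s, (M l).PosSemidef) :
    (Matrix.of fun j k => ∏ l ∈ s, M l j k).PosSemidef := by
  classical
  induction s using Finset.induction_on with
  | empty =>
    have allOnes := Matrix.posSemidef_vecMulVec_self_star (fun _ : ι => (1 : 𝕜))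
    convert allOnes using 1
    ext j k
    simp [Matrix.vecMulVec]
  | insert a s ha ih =>
    have hadamard := (hM a (Finset.mem_insert_self a s)).hadamard
      (ih fun l hl => hM l (Finset.mem_insert_of_mem hl))
    convert hadamard using 1
    ext j k
    simp [Finset.prod_insert ha]

lemma posSemidef_integral_star_mul {ι Ω 𝕜 : Type*} [Finite ι] [RCLike 𝕜] [MeasurableSpace Ω]
    {μ : Measure Ω} {v : ι → Ω → 𝕜} (hv : ∀ i, MemLp (v i) 2 μ) :
    (Matrix.of fun j k => ∫ x, star (v j x) * v k x ∂μ).PosSemidef := by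
  convert Matrix.posSemidef_gram 𝕜 fun i => (hv i).toLp (v i) using 1
  ext j k
  rw [Matrix.of_apply, Matrix.gram_apply, L2.inner_def]
  refine integral_congr_ae ?_
  filter_upwards [(hv j).coeFn_toLp, (hv k).coeFn_toLp] with x hj hk
  rw [hj, hk, RCLike.inner_apply, RCLike.star_def, mul_comm]

lemma posSemidef_laplaceFourier {ι : Type*} [Finite ι] {μ : Measure ℝ}
    (hμ : ∀ z : ℂ, Integrable (fun t : ℝ => Complex.exp (-Complex.I * t * z)) μ) (z : ι → ℂ) :
    (Matrix.of fun j k =>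
      ∫ t : ℝ, Complex.exp (-Complex.I * t * (z j - starRingEnd ℂ (z k))) ∂μ).PosSemidef := by
  have star_mul_exp (j k : ι) (t : ℝ) :
      star (Complex.exp (Complex.I * t * starRingEnd ℂ (z j))) *
        Complex.exp (Complex.I * t * starRingEnd ℂ (z k)) =
      Complex.exp (-Complex.I * t * (z j - starRingEnd ℂ (z k))) := by
    rw [Complex.star_def, ← Complex.exp_conj, ← Complex.exp_add]
    simp only [map_mul, Complex.conj_I, Complex.conj_ofReal, Complex.conj_conj]
    ring_nf
  have memLp (j : ι) :
      MemLp (fun t : ℝ => Complex.exp (Complex.I * t * starRingEnd ℂ (z j))) 2 μ := by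
    rw [memLp_two_iff_integrable_sq_norm (by fun_prop)]
    refine (hμ (z j - starRingEnd ℂ (z j))).norm.congr (.of_forall fun t => ?_)
    simp only [← star_mul_exp, norm_mul, norm_star, sq]
  simpa only [star_mul_exp] using posSemidef_integral_star_mul memLp

lemma posSemidef_laplaceFourier_density {ι : Type*} [Finite ι] {φ : ℝ → ℝ} (hφ : ∀ t, 0 ≤ φ t)
    (hint : ∀ z : ℂ, Integrable fun t : ℝ => Complex.exp (-Complex.I * t * z) * (φ t : ℂ))
    (z : ι → ℂ) :
    (Matrix.of fun j k =>
      ∫ t : ℝ, Complex.exp (-Complex.I * t * (z j - starRingEnd ℂ (z k))) *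
        (φ t : ℂ)).PosSemidef := by
  have φ_meas : AEMeasurable (fun t => ENNReal.ofReal (φ t)) := by
    have φ_int : Integrable fun t => (φ t : ℂ) := by simpa using hint 0
    exact φ_int.re.aemeasurable.ennreal_ofReal
  have finite : ∀ᵐ t, ENNReal.ofReal (φ t) < ⊤ := .of_forall fun _ => ENNReal.ofReal_lt_top
  have smul_eq (w : ℂ) (t : ℝ) : (ENNReal.ofReal (φ t)).toReal • w = w * (φ t : ℂ) := by
    rw [ENNReal.toReal_ofReal (hφ t), Complex.real_smul, mul_comm]
  have := posSemidef_laplaceFourier (μ := volume.withDensity fun t => ENNReal.ofReal (φ t))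
    (fun w => by
      rw [integrable_withDensity_iff_integrable_smul₀' φ_meas finite]
      simpa only [smul_eq] using hint w) z
  simpa only [integral_withDensity_eq_integral_toReal_smul₀ φ_meas finite, smul_eq] using this

end PositiveSemidefinite

section Mellin

open MeasureTheory Set

lemma integral_norm_cpow_smul_comp_mul {E : Type*} [NormedAddCommGroup E] [NormedSpace ℂ E]
    (g : ℝ → E) (s : ℂ) {a : ℝ} (ha : 0 < a) :
    ∫ x : ℝ in Ioi 0, ‖(x : ℂ) ^ (s - 1) • g (a * x)‖ =
      a ^ (-s.re) * ∫ x : ℝ in Ioi 0, ‖(x : ℂ) ^ (s - 1) • g x‖ := by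
  have norm_eq (x : ℝ) (hx : x ∈ Ioi 0) : ‖(x : ℂ) ^ (s - 1) • g (a * x)‖ =
      a ^ (1 - s.re) * ‖((a * x : ℝ) : ℂ) ^ (s - 1) • g (a * x)‖ := by
    have hx : 0 < x := hx
    rw [norm_smul, norm_smul, Complex.norm_cpow_eq_rpow_re_of_pos hx,
      Complex.norm_cpow_eq_rpow_re_of_pos (mul_pos ha hx), Complex.sub_re, Complex.one_re,
      Real.mul_rpow ha.le hx.le, ← mul_assoc, ← mul_assoc, ← Real.rpow_add ha]
    simp
  rw [setIntegral_congr_fun measurableSet_Ioi norm_eq, integral_const_mul,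
    integral_comp_mul_left_Ioi (fun y : ℝ => ‖(y : ℂ) ^ (s - 1) • g y‖) 0 ha, mul_zero, smul_eq_mul,
    ← mul_assoc, ← Real.rpow_neg_one a, ← Real.rpow_add ha]
  ring_nf

lemma hasSum_mellin_comp_mul {ι E : Type*} [Countable ι] [NormedAddCommGroup E] [NormedSpace ℂ E]
    {lam : ι → ℝ} {g : ℝ → E} {s : ℂ} (hlam : ∀ i, 0 < lam i) (hg : MellinConvergent g s)
    (hsum : Summable fun i => lam i ^ (-s.re)) :
    HasSum (fun i => (lam i : ℂ) ^ (-s) • mellin g s)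
      (mellin (fun x => ∑' i, g (lam i * x)) s) := by
  have hasSum_integral := hasSum_integral_of_summable_integral_norm
    (μ := volume.restrict (Ioi 0)) (F := fun i (x : ℝ) => (x : ℂ) ^ (s - 1) • g (lam i * x))
    (fun i => (MellinConvergent.comp_mul_left (hlam i)).mpr hg)
    (by simpa only [integral_norm_cpow_smul_comp_mul g s (hlam _)] using hsum.mul_right _)
  simp only [tsum_const_smul''] at hasSum_integral
  refine hasSum_integral.congr_fun ?_
  exact fun i => (mellin_comp_mul_left g s (hlam i)).symm

section ExpSubstitution

variable {E : Type*} [NormedAddCommGroup E] [NormedSpace ℂ E]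

lemma exp_smul_exp_cpow_sub_one_smul (s : ℂ) (t : ℝ) (e : E) :
    Real.exp t • ((Real.exp t : ℂ) ^ (s - 1) • e) = Complex.exp (s * t) • e := by
  rw [Complex.ofReal_exp, Complex.cpow_def_of_ne_zero (Complex.exp_ne_zero _),
    ← Complex.ofReal_exp, ← Complex.ofReal_log (Real.exp_pos _).le, Real.log_exp,
    ← Complex.coe_smul, smul_smul, Complex.ofReal_exp, ← Complex.exp_add]
  ring_nf

variable {f : ℝ → E} {s : ℂ}

lemma mellinConvergent_iff_integrable_exp :
    MellinConvergent f s ↔ Integrable fun t : ℝ => Complex.exp (s * t) • f (Real.exp t) := by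
  rw [MellinConvergent, ← Real.range_exp, ← image_univ,
    integrableOn_image_iff_integrableOn_abs_deriv_smul MeasurableSet.univ
      (fun t _ => (Real.hasDerivAt_exp t).hasDerivWithinAt) Real.exp_injective.injOn,
    integrableOn_univ]
  simp only [abs_of_pos (Real.exp_pos _), exp_smul_exp_cpow_sub_one_smul]

lemma mellin_eq_integral_exp :
    mellin f s = ∫ t : ℝ, Complex.exp (s * t) • f (Real.exp t) := by
  rw [mellin, ← Real.range_exp, ← image_univ,
    integral_image_eq_integral_abs_deriv_smul MeasurableSet.univ
      (fun t _ => (Real.hasDerivAt_exp t).hasDerivWithinAt) Real.exp_injective.injOn,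
    setIntegral_univ]
  simp only [abs_of_pos (Real.exp_pos _), exp_smul_exp_cpow_sub_one_smul]

end ExpSubstitution

end Mellin

section ExpSeries

open Set Asymptotics

/-- The series `∑ᵢ (-λᵢ)ᵏ e^{-λᵢ x}`, which is the `k`-th derivative of `∑ᵢ e^{-λᵢ x}`. -/
noncomputable def expSeries {ι : Type*} (lam : ι → ℝ) (k : ℕ) (x : ℝ) : ℝ :=
  ∑' i, (-lam i) ^ k * Real.exp (-lam i * x)

lemma pow_mul_exp_neg_le {l x : ℝ} (hl : 0 ≤ l) (hx : 0 < x) (k : ℕ) :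
    l ^ k * Real.exp (-l * x) ≤ k.factorial * (2 / x) ^ k * Real.exp (-l * (x / 2)) := by
  have hpow : l ^ k ≤ k.factorial * (2 / x) ^ k * Real.exp (l * (x / 2)) := by
    have h := Real.pow_div_factorial_le_exp (l * (x / 2)) (by positivity) k
    calc l ^ k = k.factorial * (2 / x) ^ k * ((l * (x / 2)) ^ k / k.factorial) := by
          rw [mul_assoc, mul_div_assoc', ← mul_pow]
          field_simp
      _ ≤ _ := by gcongr
  calc l ^ k * Real.exp (-l * x)
      ≤ k.factorial * (2 / x) ^ k * Real.exp (l * (x / 2)) * Real.exp (-l * x) := by gcongr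
    _ = k.factorial * (2 / x) ^ k * Real.exp (-l * (x / 2)) := by
        rw [mul_assoc, ← Real.exp_add]
        ring_nf

lemma norm_neg_pow_mul_exp {l : ℝ} (hl : 0 ≤ l) (k : ℕ) (y : ℝ) :
    ‖(-l) ^ k * Real.exp y‖ = l ^ k * Real.exp y := by
  rw [norm_mul, norm_pow, norm_neg, Real.norm_of_nonneg hl, Real.norm_of_nonneg (Real.exp_nonneg _)]

variable {ι : Type*} {lam : ι → ℝ}

lemma summable_pow_mul_exp_neg (hlam : ∀ i, 0 ≤ lam i)
    (hsum : ∀ x > 0, Summable fun i => Real.exp (-lam i * x)) (k : ℕ) {x : ℝ} (hx : 0 < x) :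
    Summable fun i => lam i ^ k * Real.exp (-lam i * x) :=
  .of_nonneg_of_le (fun i => mul_nonneg (pow_nonneg (hlam i) k) (Real.exp_nonneg _))
    (fun i => pow_mul_exp_neg_le (hlam i) hx k) ((hsum _ (half_pos hx)).mul_left _)

lemma summable_expSeries (hlam : ∀ i, 0 ≤ lam i)
    (hsum : ∀ x > 0, Summable fun i => Real.exp (-lam i * x)) (k : ℕ) {x : ℝ} (hx : 0 < x) :
    Summable fun i => (-lam i) ^ k * Real.exp (-lam i * x) :=
  .of_norm_bounded (summable_pow_mul_exp_neg hlam hsum k hx)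
    fun i => (norm_neg_pow_mul_exp (hlam i) k _).le

lemma hasDerivAt_expSeries (hlam : ∀ i, 0 ≤ lam i)
    (hsum : ∀ x > 0, Summable fun i => Real.exp (-lam i * x)) (k : ℕ) {x : ℝ} (hx : 0 < x) :
    HasDerivAt (expSeries lam k) (expSeries lam (k + 1) x) x := by
  refine hasDerivAt_tsum_of_isPreconnected (t := Ioi (x / 2)) (y₀ := x)
    (g := fun i y => (-lam i) ^ k * Real.exp (-lam i * y))
    (g' := fun i y => (-lam i) ^ (k + 1) * Real.exp (-lam i * y))
    (summable_pow_mul_exp_neg hlam hsum (k + 1) (half_pos hx)) isOpen_Ioi isPreconnected_Ioi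
    (fun i y _ => ?_) (fun i y hy => ?_) (half_lt_self hx) (summable_expSeries hlam hsum k hx)
    (half_lt_self hx)
  · refine ((((hasDerivAt_id y).const_mul (-lam i)).exp).const_mul ((-lam i) ^ k)).congr_deriv ?_
    simp only [id, mul_one]
    ring
  · have hl := hlam i
    rw [norm_neg_pow_mul_exp hl, neg_mul, neg_mul]
    gcongr
    exact (mem_Ioi.mp hy).le

lemma continuousOn_expSeries (hlam : ∀ i, 0 ≤ lam i)
    (hsum : ∀ x > 0, Summable fun i => Real.exp (-lam i * x)) (k : ℕ) :
    ContinuousOn (expSeries lam k) (Ioi 0) :=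
  fun _ hx => (hasDerivAt_expSeries hlam hsum k hx).continuousAt.continuousWithinAt

lemma expSeries_isBigO_exp (hlam : ∀ i, 0 ≤ lam i)
    (hsum : ∀ x > 0, Summable fun i => Real.exp (-lam i * x))
    {c : ℝ} (hc : ∀ i, c ≤ lam i) (k : ℕ) :
    expSeries lam k =O[atTop] fun x => Real.exp (-c * x) := by
  refine .of_bound ((∑' i, lam i ^ k * Real.exp (-lam i * 1)) * Real.exp c) ?_
  filter_upwards [eventually_ge_atTop 1] with x hx
  have term_le (i : ι) : ‖(-lam i) ^ k * Real.exp (-lam i * x)‖ ≤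
      lam i ^ k * Real.exp (-lam i * 1) * (Real.exp c * Real.exp (-c * x)) := by
    have hl := hlam i
    rw [norm_neg_pow_mul_exp hl, mul_assoc, ← Real.exp_add, ← Real.exp_add]
    gcongr
    nlinarith [hc i]
  calc ‖expSeries lam k x‖
      ≤ (∑' i, lam i ^ k * Real.exp (-lam i * 1)) * (Real.exp c * Real.exp (-c * x)) :=
        tsum_of_norm_bounded
          ((summable_pow_mul_exp_neg hlam hsum k one_pos).hasSum.mul_right _) term_le
    _ = _ := by rw [Real.norm_of_nonneg (Real.exp_nonneg _), mul_assoc]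

end ExpSeries

section XiKernel

open Set Asymptotics

/-- The exponents `π n²`, `n ≥ 1`, of the theta series, indexed from `0`. -/
noncomputable def thetaExponent (n : ℕ) : ℝ := Real.pi * ((n : ℝ) + 1) ^ 2

lemma pi_le_thetaExponent (n : ℕ) : Real.pi ≤ thetaExponent n :=
  le_mul_of_one_le_right Real.pi_pos.le (one_le_pow₀ (by simp))

lemma thetaExponent_pos (n : ℕ) : 0 < thetaExponent n :=
  Real.pi_pos.trans_le (pi_le_thetaExponent n)

lemma thetaExponent_nonneg (n : ℕ) : 0 ≤ thetaExponent n :=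
  (thetaExponent_pos n).le

lemma hasSum_exp_neg_thetaExponent {x : ℝ} (hx : 0 < x) :
    HasSum (fun n => Real.exp (-thetaExponent n * x)) ((HurwitzZeta.evenKernel 0 x - 1) / 2) := by
  have h := (HurwitzZeta.hasSum_nat_cosKernel₀ 0 hx).div_const 2
  simpa [HurwitzZeta.evenKernel_eq_cosKernel_of_zero, thetaExponent] using h

lemma summable_exp_neg_thetaExponent (x : ℝ) (hx : 0 < x) :
    Summable fun n => Real.exp (-thetaExponent n * x) :=
  (hasSum_exp_neg_thetaExponent hx).summable

lemma evenKernel_zero_eq_expSeries {x : ℝ} (hx : 0 < x) :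
    HurwitzZeta.evenKernel 0 x = 1 + 2 * expSeries thetaExponent 0 x := by
  simp only [expSeries, pow_zero, one_mul, (hasSum_exp_neg_thetaExponent hx).tsum_eq]
  ring

lemma hasDerivAt_expSeries_thetaExponent (k : ℕ) {x : ℝ} (hx : 0 < x) :
    HasDerivAt (expSeries thetaExponent k) (expSeries thetaExponent (k + 1) x) x :=
  hasDerivAt_expSeries thetaExponent_nonneg summable_exp_neg_thetaExponent k hx

/-- The summand `(2 y² - 3 y) e^{-y}` of Riemann's kernel. -/
noncomputable def xiTerm (y : ℝ) : ℝ := (2 * y ^ 2 - 3 * y) * Real.exp (-y)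

/-- Riemann's kernel `∑ (2 π² n⁴ x² - 3 π n² x) e^{-π n² x}`, `n ≥ 1`, whose Mellin transform at
`s / 2` is `ξ(s)`. -/
noncomputable def xiKernel (x : ℝ) : ℝ := ∑' n, xiTerm (thetaExponent n * x)

lemma hasSum_xiKernel {x : ℝ} (hx : 0 < x) :
    HasSum (fun n => xiTerm (thetaExponent n * x))
      (2 * x ^ 2 * expSeries thetaExponent 2 x + 3 * x * expSeries thetaExponent 1 x) := by
  have hasSum (k : ℕ) : HasSum _ (expSeries thetaExponent k x) :=
    (summable_expSeries thetaExponent_nonneg summable_exp_neg_thetaExponent k hx).hasSum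
  refine (((hasSum 2).mul_left (2 * x ^ 2)).add ((hasSum 1).mul_left (3 * x))).congr_fun
    fun n => ?_
  rw [xiTerm, neg_mul]
  ring

lemma xiKernel_eq_expSeries {x : ℝ} (hx : 0 < x) :
    xiKernel x = 2 * x ^ 2 * expSeries thetaExponent 2 x + 3 * x * expSeries thetaExponent 1 x :=
  (hasSum_xiKernel hx).tsum_eq

lemma xiTerm_pos {y : ℝ} (hy : 3 / 2 < y) : 0 < xiTerm y :=
  mul_pos (by nlinarith) (Real.exp_pos _)

lemma xiKernel_pos_of_one_le {x : ℝ} (hx : 1 ≤ x) : 0 < xiKernel x := by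
  have term_pos (n : ℕ) : 0 < xiTerm (thetaExponent n * x) :=
    xiTerm_pos (by nlinarith [Real.pi_gt_three, pi_le_thetaExponent n])
  exact (hasSum_xiKernel (one_pos.trans_le hx)).summable.tsum_pos (fun n => (term_pos n).le) 0
    (term_pos 0)

lemma continuousOn_xiKernel : ContinuousOn xiKernel (Ioi 0) := by
  have continuousOn (k : ℕ) : ContinuousOn (expSeries thetaExponent k) (Ioi 0) :=
    continuousOn_expSeries thetaExponent_nonneg summable_exp_neg_thetaExponent k
  refine ContinuousOn.congr ?_ fun x hx => xiKernel_eq_expSeries hx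
  have := continuousOn 1
  have := continuousOn 2
  fun_prop

lemma xiKernel_isBigO_rpow (r : ℝ) : xiKernel =O[atTop] fun x : ℝ => x ^ r := by
  have pow_mul_isBigO (c : ℝ) (j k : ℕ) :
      (fun x => c * x ^ j * expSeries thetaExponent k x) =O[atTop] fun x : ℝ => x ^ r := by
    have expSeries_isBigO := (expSeries_isBigO_exp thetaExponent_nonneg
      summable_exp_neg_thetaExponent pi_le_thetaExponent k).trans
      (isLittleO_exp_neg_mul_rpow_atTop Real.pi_pos (r - j)).isBigO
    refine (((isBigO_refl (fun x : ℝ => x ^ j) atTop).const_mul_left c).mul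
      expSeries_isBigO).congr' .rfl ?_
    filter_upwards [eventually_gt_atTop 0] with x hx
    rw [← Real.rpow_natCast, ← Real.rpow_add hx, add_sub_cancel]
  refine ((pow_mul_isBigO 2 2 2).add (pow_mul_isBigO 3 1 1)).congr' ?_ .rfl
  filter_upwards [eventually_gt_atTop 0] with x hx
  rw [xiKernel_eq_expSeries hx, pow_one]

end XiKernel

section XiDensity

/-- Jacobi's theta function in the logarithmic coordinate `x = e^{2t}`, normalised so that its
functional equation reads `logTheta (-t) = logTheta t`. -/
noncomputable def logTheta (t : ℝ) : ℝ :=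
  Real.exp (t / 2) * HurwitzZeta.evenKernel 0 (Real.exp (2 * t))

/-- The density whose Fourier transform is the Riemann Xi function. -/
noncomputable def xiDensity (t : ℝ) : ℝ := 2 * Real.exp (t / 2) * xiKernel (Real.exp (2 * t))

lemma logTheta_neg (t : ℝ) : logTheta (-t) = logTheta t := by
  have exp_rpow : Real.exp (2 * -t) ^ (1 / 2 : ℝ) = Real.exp (-t) := by
    rw [← Real.exp_mul]
    ring_nf
  have exp_inv : 1 / Real.exp (2 * -t) = Real.exp (2 * t) := by
    rw [one_div, ← Real.exp_neg]
    ring_nf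
  rw [logTheta, logTheta, HurwitzZeta.evenKernel_functional_equation, exp_rpow, exp_inv,
    ← HurwitzZeta.evenKernel_eq_cosKernel_of_zero, one_div, ← Real.exp_neg, ← mul_assoc,
    ← Real.exp_add]
  ring_nf

lemma hasDerivAt_exp_half_mul {f : ℝ → ℝ} {f' t : ℝ}
    (hf : HasDerivAt f f' (Real.exp (2 * t))) :
    HasDerivAt (fun u => Real.exp (u / 2) * f (Real.exp (2 * u)))
      (Real.exp (t / 2) * (f (Real.exp (2 * t)) / 2 + 2 * Real.exp (2 * t) * f')) t := by
  have exp_half : HasDerivAt (fun u : ℝ => Real.exp (u / 2)) (Real.exp (t / 2) * (1 / 2)) t :=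
    ((hasDerivAt_id t).div_const 2).exp
  have exp_two : HasDerivAt (fun u : ℝ => Real.exp (2 * u)) (Real.exp (2 * t) * (2 * 1)) t :=
    ((hasDerivAt_id t).const_mul 2).exp
  refine (exp_half.mul (hf.comp t exp_two)).congr_deriv ?_
  simp only [Function.comp_apply]
  ring

lemma deriv_logTheta (t : ℝ) : deriv logTheta t = Real.exp (t / 2) *
    (1 / 2 + expSeries thetaExponent 0 (Real.exp (2 * t)) +
      4 * Real.exp (2 * t) * expSeries thetaExponent 1 (Real.exp (2 * t))) := by
  have logTheta_eq : logTheta = fun u =>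
      Real.exp (u / 2) * (1 + 2 * expSeries thetaExponent 0 (Real.exp (2 * u))) := by
    ext u
    rw [logTheta, evenKernel_zero_eq_expSeries (Real.exp_pos _)]
  rw [logTheta_eq, (hasDerivAt_exp_half_mul (((hasDerivAt_expSeries_thetaExponent 0
    (Real.exp_pos (2 * t))).const_mul 2).const_add 1)).deriv]
  ring

lemma deriv_deriv_logTheta (t : ℝ) : deriv (deriv logTheta) t = Real.exp (t / 2) *
    (1 / 4 + expSeries thetaExponent 0 (Real.exp (2 * t)) / 2 +
      12 * Real.exp (2 * t) * expSeries thetaExponent 1 (Real.exp (2 * t)) +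
      8 * Real.exp (2 * t) ^ 2 * expSeries thetaExponent 2 (Real.exp (2 * t))) := by
  have hx := Real.exp_pos (2 * t)
  have bracket := ((hasDerivAt_expSeries_thetaExponent 0 hx).const_add (1 / 2)).add
    (((hasDerivAt_id (Real.exp (2 * t))).const_mul 4).mul (hasDerivAt_expSeries_thetaExponent 1 hx))
  rw [funext deriv_logTheta]
  refine (hasDerivAt_exp_half_mul bracket).deriv.trans ?_
  simp only [Pi.add_apply, Pi.mul_apply, id]
  ring

lemma xiDensity_eq_deriv_logTheta (t : ℝ) :
    xiDensity t = (deriv (deriv logTheta) t - logTheta t / 4) / 2 := by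
  rw [xiDensity, xiKernel_eq_expSeries (Real.exp_pos _), deriv_deriv_logTheta, logTheta,
    evenKernel_zero_eq_expSeries (Real.exp_pos _)]
  ring

lemma xiDensity_neg (t : ℝ) : xiDensity (-t) = xiDensity t := by
  have deriv_neg (u : ℝ) : deriv logTheta (-u) = -deriv logTheta u := by
    have := deriv_comp_neg logTheta u
    simp only [logTheta_neg] at this
    linarith
  have deriv_deriv_neg : deriv (deriv logTheta) (-t) = deriv (deriv logTheta) t := by
    have := deriv_comp_neg (deriv logTheta) t
    simp only [deriv_neg, deriv.fun_neg] at this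
    linarith
  rw [xiDensity_eq_deriv_logTheta, xiDensity_eq_deriv_logTheta, deriv_deriv_neg, logTheta_neg]

lemma xiDensity_pos (t : ℝ) : 0 < xiDensity t := by
  wlog ht : 0 ≤ t generalizing t
  · rw [← xiDensity_neg]
    exact this (-t) (by linarith)
  have := xiKernel_pos_of_one_le (Real.one_le_exp (show 0 ≤ 2 * t by positivity))
  unfold xiDensity
  positivity

lemma xiKernel_inv {x : ℝ} (hx : 0 < x) : xiKernel x⁻¹ = x ^ (1 / 2 : ℝ) * xiKernel x := by
  obtain ⟨t, rfl⟩ : ∃ t, Real.exp (2 * t) = x :=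
    ⟨Real.log x / 2, by rw [mul_div_cancel₀ _ two_ne_zero, Real.exp_log hx]⟩
  have density_even := xiDensity_neg t
  rw [xiDensity, xiDensity, mul_neg, Real.exp_neg, neg_div, Real.exp_neg] at density_even
  rw [← Real.exp_mul, show 2 * t * (1 / 2) = t / 2 + t / 2 by ring, Real.exp_add, ← one_div]
  field_simp at density_even
  linarith

end XiDensity

section XiMellin

open MeasureTheory Set

/-- `xiKernel` paired with itself by the functional equation `K(1/x) = x^{1/2} K(x)`, in the format
for which Hecke's theory of Mellin transforms is available. -/
noncomputable def xiKernelFEPair : WeakFEPair ℂ where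
  f x := xiKernel x
  g x := xiKernel x
  k := 1 / 2
  ε := 1
  f₀ := 0
  g₀ := 0
  hf_int := (Complex.continuous_ofReal.comp_continuousOn
    continuousOn_xiKernel).locallyIntegrableOn measurableSet_Ioi
  hg_int := (Complex.continuous_ofReal.comp_continuousOn
    continuousOn_xiKernel).locallyIntegrableOn measurableSet_Ioi
  hk := by norm_num
  hε := one_ne_zero
  h_feq x hx := by
    rw [one_div x, xiKernel_inv hx]
    simp
  hf_top r := by simpa using Complex.isBigO_ofReal_left.mpr (xiKernel_isBigO_rpow r)
  hg_top r := by simpa using Complex.isBigO_ofReal_left.mpr (xiKernel_isBigO_rpow r)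

lemma isStrongFEPair_xiKernelFEPair : IsStrongFEPair xiKernelFEPair := ⟨rfl, rfl⟩

lemma mellinConvergent_xiKernel (s : ℂ) : MellinConvergent (fun x => (xiKernel x : ℂ)) s :=
  (isStrongFEPair_xiKernelFEPair.hasMellin s).1

lemma differentiable_mellin_xiKernel :
    Differentiable ℂ (mellin fun x => (xiKernel x : ℂ)) := by
  have h := isStrongFEPair_xiKernelFEPair.differentiable_Λ
  rwa [isStrongFEPair_xiKernelFEPair.Λ_eq] at h

lemma hasMellin_pow_mul_exp_neg (k : ℕ) {s : ℂ} (hs : 0 < s.re) :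
    HasMellin (fun x : ℝ => (x : ℂ) ^ k * (Real.exp (-x) : ℂ)) s (Complex.Gamma (s + k)) := by
  have hsk : 0 < (s + k).re := by
    rw [Complex.add_re, Complex.natCast_re]
    positivity
  have exp_convergent : MellinConvergent (fun x : ℝ => (Real.exp (-x) : ℂ)) (s + k) := by
    refine (Complex.GammaIntegral_convergent hsk).congr_fun (fun x _ => ?_) measurableSet_Ioi
    simp [mul_comm]
  have cpow_smul : (fun x : ℝ => (x : ℂ) ^ k * (Real.exp (-x) : ℂ)) =
      fun x : ℝ => (x : ℂ) ^ (k : ℂ) • (Real.exp (-x) : ℂ) := by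
    ext x
    rw [Complex.cpow_natCast, smul_eq_mul]
  rw [cpow_smul, Complex.Gamma_eq_integral hsk, Complex.GammaIntegral_eq_mellin, ← mellin_cpow_smul]
  exact ⟨MellinConvergent.cpow_smul.mpr exp_convergent, rfl⟩

lemma hasMellin_xiTerm {s : ℂ} (hs : 0 < s.re) :
    HasMellin (fun x => (xiTerm x : ℂ)) s (s * (2 * s - 1) * Complex.Gamma s) := by
  have ne_zero : s ≠ 0 := Complex.ne_zero_of_re_pos hs
  have add_one_ne_zero : s + 1 ≠ 0 := Complex.ne_zero_of_re_pos (by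
    rw [Complex.add_re, Complex.one_re]
    positivity)
  have sq := hasMellin_pow_mul_exp_neg 2 hs
  have lin := hasMellin_pow_mul_exp_neg 1 hs
  have h := hasMellin_sub (sq.1.const_smul (2 : ℂ)) (lin.1.const_smul (3 : ℂ))
  rw [mellin_const_smul, mellin_const_smul, sq.2, lin.2] at h
  have Gamma_add_two : Complex.Gamma (s + (2 : ℕ)) = (s + 1) * (s * Complex.Gamma s) := by
    rw [← Complex.Gamma_add_one _ ne_zero, ← Complex.Gamma_add_one _ add_one_ne_zero]
    norm_num [add_assoc]
  convert h using 1
  · ext x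
    simp only [xiTerm, smul_eq_mul]
    push_cast
    ring
  · rw [Gamma_add_two, Nat.cast_one, Complex.Gamma_add_one _ ne_zero]
    simp only [smul_eq_mul]
    ring

lemma thetaExponent_cpow_neg (n : ℕ) (s : ℂ) :
    (thetaExponent n : ℂ) ^ (-s) = (Real.pi : ℂ) ^ (-s) * (1 / ((n : ℂ) + 1) ^ (2 * s)) := by
  have sq_cpow : (((n : ℂ) + 1) ^ 2) ^ s = ((n : ℂ) + 1) ^ (2 * s) := by
    exact_mod_cast (Complex.natCast_cpow_natCast_mul (n + 1) 2 s).symm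
  rw [thetaExponent, Complex.ofReal_mul,
    Complex.mul_cpow_ofReal_nonneg Real.pi_pos.le (by positivity), ← sq_cpow,
    Complex.cpow_neg ((((n : ℝ) + 1) ^ 2 : ℝ) : ℂ), one_div]
  push_cast
  rfl

lemma summable_thetaExponent_rpow_neg {r : ℝ} (hr : 1 / 2 < r) :
    Summable fun n => thetaExponent n ^ (-r) := by
  have := ((summable_nat_add_iff 1).mpr
    (Real.summable_nat_rpow.mpr (show -(2 * r) < -1 by linarith))).mul_left (Real.pi ^ (-r))
  refine this.congr fun n => ?_
  rw [thetaExponent, Real.mul_rpow Real.pi_pos.le (by positivity), ← Real.rpow_natCast,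
    ← Real.rpow_mul (by positivity)]
  push_cast
  ring_nf

lemma one_lt_two_mul_re {s : ℂ} (hs : 1 / 2 < s.re) : 1 < (2 * s).re := by
  rw [Complex.mul_re, Complex.re_ofNat, Complex.im_ofNat]
  linarith

lemma completedRiemannZeta_eq_tsum_mul_Gamma {s : ℂ} (hs : 1 / 2 < s.re) :
    completedRiemannZeta (2 * s) = (∑' n, (thetaExponent n : ℂ) ^ (-s)) * Complex.Gamma s := by
  have two_mul_re := one_lt_two_mul_re hs
  have Gammaℝ_ne_zero : Complex.Gammaℝ (2 * s) ≠ 0 :=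
    Complex.Gammaℝ_ne_zero_of_re_pos (one_pos.trans two_mul_re)
  have zeta := riemannZeta_def_of_ne_zero (Complex.ne_zero_of_one_lt_re two_mul_re)
  rw [eq_div_iff Gammaℝ_ne_zero] at zeta
  simp only [thetaExponent_cpow_neg, tsum_mul_left]
  rw [← zeta, zeta_eq_tsum_one_div_nat_add_one_cpow two_mul_re, Complex.Gammaℝ_def,
    mul_div_cancel_left₀ _ two_ne_zero, neg_div, mul_div_cancel_left₀ _ two_ne_zero]
  ring

lemma mellin_xiKernel_of_half_lt_re {s : ℂ} (hs : 1 / 2 < s.re) :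
    mellin (fun x => (xiKernel x : ℂ)) s = s * (2 * s - 1) * completedRiemannZeta (2 * s) := by
  have term := hasMellin_xiTerm (s := s) (by linarith)
  have h := hasSum_mellin_comp_mul thetaExponent_pos term.1 (summable_thetaExponent_rpow_neg hs)
  simp only [term.2, smul_eq_mul, ← Complex.ofReal_tsum] at h
  calc mellin (fun x => (xiKernel x : ℂ)) s
      = ∑' n, (thetaExponent n : ℂ) ^ (-s) * (s * (2 * s - 1) * Complex.Gamma s) := h.tsum_eq.symm
    _ = _ := by
      rw [tsum_mul_right, completedRiemannZeta_eq_tsum_mul_Gamma hs]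
      ring

lemma mul_completedRiemannZeta_eq {s : ℂ} (h0 : s ≠ 0) (h1 : s ≠ 1) :
    s * (s - 1) * completedRiemannZeta s = s * (s - 1) * completedRiemannZeta₀ s + 1 := by
  rw [completedRiemannZeta_eq]
  linear_combination (1 - s) * mul_one_div_cancel h0 +
    s * mul_one_div_cancel (sub_ne_zero.mpr h1.symm)

lemma mellin_xiKernel (s : ℂ) :
    mellin (fun x => (xiKernel x : ℂ)) s =
      (2 * s * (2 * s - 1) * completedRiemannZeta₀ (2 * s) + 1) / 2 := by
  have differentiable_rhs : Differentiable ℂ fun s : ℂ =>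
      (2 * s * (2 * s - 1) * completedRiemannZeta₀ (2 * s) + 1) / 2 := by
    have := differentiable_completedZeta₀
    fun_prop
  refine congrFun (AnalyticOnNhd.eq_of_eventuallyEq (z₀ := 1)
    (fun w _ => differentiable_mellin_xiKernel.analyticAt w)
    (fun w _ => differentiable_rhs.analyticAt w) ?_) s
  have half_lt_re : ∀ᶠ w : ℂ in 𝓝 1, 1 / 2 < w.re :=
    (isOpen_lt continuous_const Complex.continuous_re).mem_nhds (by norm_num)
  filter_upwards [half_lt_re] with w hw
  have two_mul_re := one_lt_two_mul_re hw
  rw [mellin_xiKernel_of_half_lt_re hw]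
  linear_combination mul_completedRiemannZeta_eq (Complex.ne_zero_of_one_lt_re two_mul_re)
    (ne_of_apply_ne Complex.re two_mul_re.ne') / 2

lemma riemannXi_eq_mellin (z : ℂ) :
    riemannXi z = mellin (fun x => (xiKernel x : ℂ)) ((1 + 2 * Complex.I * z) / 4) := by
  rw [(riemannXi_eq z).2, mellin_xiKernel]
  ring_nf

lemma exp_mul_xiKernel_exp (z : ℂ) (t : ℝ) :
    Complex.exp ((1 + 2 * Complex.I * z) / 4 * ↑(-2 * t)) * (xiKernel (Real.exp (-2 * t)) : ℂ) =
      Complex.exp (-Complex.I * t * z) * (xiDensity t : ℂ) / 2 := by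
  have exp_add : Complex.exp ((1 + 2 * Complex.I * z) / 4 * ↑(-2 * t)) =
      Complex.exp (-Complex.I * t * z) * Complex.exp (-t / 2) := by
    rw [← Complex.exp_add]
    push_cast
    ring_nf
  rw [← xiDensity_neg, xiDensity, exp_add, show 2 * -t = -2 * t by ring]
  push_cast
  ring

lemma integrable_exp_mul_xiDensity (z : ℂ) :
    Integrable fun t : ℝ => Complex.exp (-Complex.I * t * z) * (xiDensity t : ℂ) := by
  have half_integrable := (mellinConvergent_iff_integrable_exp.mp (mellinConvergent_xiKernel
    ((1 + 2 * Complex.I * z) / 4))).comp_mul_left' (R := -2) (by norm_num)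
  simp only [smul_eq_mul, exp_mul_xiKernel_exp] at half_integrable
  simpa using half_integrable.mul_const 2

lemma riemannXi_eq_integral (z : ℂ) :
    riemannXi z = ∫ t : ℝ, Complex.exp (-Complex.I * t * z) * (xiDensity t : ℂ) := by
  have half_eq := Measure.integral_comp_mul_left (fun t : ℝ =>
    Complex.exp ((1 + 2 * Complex.I * z) / 4 * t) • (xiKernel (Real.exp t) : ℂ)) (-2)
  rw [← mellin_eq_integral_exp (f := fun x => (xiKernel x : ℂ)), ← riemannXi_eq_mellin] at half_eq
  simp only [smul_eq_mul, exp_mul_xiKernel_exp, integral_div, abs_inv, abs_neg, Nat.abs_ofNat,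
    Complex.real_smul, Complex.ofReal_inv, Complex.ofReal_ofNat] at half_eq
  linear_combination -2 * half_eq

end XiMellin

theorem mainTheorem5 :
    (∃ φ : ℝ → ℝ, (∀ t, 0 < φ t) ∧ ∀ z : ℂ,
      MeasureTheory.Integrable (fun t : ℝ => Complex.exp (-Complex.I * t * z) * (φ t : ℂ)) ∧
      riemannXi z = ∫ t : ℝ, Complex.exp (-Complex.I * t * z) * (φ t : ℂ)) ∧
    ∀ (n m : ℕ) (z : Fin n → Fin m → ℂ),
      (Matrix.of fun j k : Fin n =>
        ∏ l : Fin m, riemannXi (z j l - (starRingEnd ℂ) (z k l))).PosSemidef := by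
  refine ⟨⟨xiDensity, xiDensity_pos, fun z =>
    ⟨integrable_exp_mul_xiDensity z, riemannXi_eq_integral z⟩⟩, fun n m z => ?_⟩
  have factor_posSemidef (l : Fin m) :
      (Matrix.of fun j k => riemannXi (z j l - starRingEnd ℂ (z k l))).PosSemidef := by
    simpa only [riemannXi_eq_integral] using
      posSemidef_laplaceFourier_density (fun t => (xiDensity_pos t).le)
        integrable_exp_mul_xiDensity fun j => z j l
  exact posSemidef_prod Finset.univ fun l _ => factor_posSemidef l
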